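/- Let $k$ be an algebraically closed field of characteristic zero, let $d, r$ be integers with $d < r < 2d$, and let $a \in k$. Let $H(d) \subset k^*$ be the group of $d$-th roots of unity. Let $\tilde X(d,r)$ and $\tilde V(d,r)$ be the affine hypersurfaces in $\mathbb{A}^3 = \operatorname{Spec} k[x,y,z]$ defined by $x^r z + y^d + a x^d = 1$ and $x^r z + y^d = 1$, respectively. For $\lambda \in H(d)$ there are uniquely determined polynomials $p_\lambda, q_\lambda \in k[x]$ with $\deg p_\lambda \le r-1$, $p_\lambda(0) = \lambda$ and $x^r q_\lambda(x) + p_\lambda(x)^d + a x^d = 1$; they satisfy $p_{\lambda\omega}(\lambda x) = \lambda p_\omega(x)$ and $q_{\lambda\omega}(\lambda x) = \lambda^{-r} q_\omega(x)$ for all $\lambda, \omega \in H(d)$. Then: (1) $p_\lambda(x) = \lambda - \frac{a}{d}\lambda x^d$ for all $\lambda \in H(d)$. (2) Put $$\sigma(x,c) = \frac{1}{1-\mu}\{p_1(\mu x) - p_\mu(\mu x)\}\,c, \qquad \tau(x,c) = -\frac{a^2}{d^2}x^{2d-r} + \left(1 + \frac{a}{d}x^d\right)c,$$ where $\mu \in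 H(d)$, $\mu \neq 1$; the polynomial $\sigma \in k[x,c]$ does not depend on the choice of $\mu$. Then for all $\lambda \in H(d)$, all $x \in k^*$ and all $c \in k$, $$\lambda^{1-r}x^r\,\sigma\!\left(\lambda^{-1}x,\ \lambda^{r-1}\Big(c + \frac{1-\lambda}{x^r}\Big)\right) = x^r\sigma(x,c) + p_1(x) - p_\lambda(x),$$ $$\lambda^{1-r}x^r\,\tau\!\left(\lambda^{-1}x,\ \lambda^{r-1}\Big(c + \frac{p_1(x)-p_\lambda(x)}{x^r}\Big)\right) = x^r\tau(x,c) + 1 - \lambda.$$ Moreover, there is an isomorphism of $k$-schemes $\tilde X(d,r) \times \mathbb{A}^1 \cong \tilde V(d,r) \times \mathbb{A}^1$. -/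

import Mathlib

open CategoryTheory AlgebraicGeometry

universe u

namespace PseudoPlane

section Geometry

variable (k : Type u) [Field k]

/-- The coordinate ring `k[x, y, z] / (f)`, with `x, y, z` the variables `X 0, X 1, X 2`. -/
abbrev CoordRing (f : MvPolynomial (Fin 3) k) : Type u :=
  MvPolynomial (Fin 3) k ⧸ Ideal.span {f}

/-- The affine hypersurface `f = 0` in affine 3-space, as a scheme over `k`. -/
noncomputable def hypersurface (f : MvPolynomial (Fin 3) k) :
    Over (Spec (CommRingCat.of k)) :=
  Over.mk (Spec.map (CommRingCat.ofHom (algebraMap k (CoordRing k f))))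

/-- The affine line over `k`. -/
noncomputable def affineLine : Over (Spec (CommRingCat.of k)) :=
  Over.mk (Spec.map (CommRingCat.ofHom (algebraMap k (Polynomial k))))

/-- The surface `x ^ r * z + y ^ d + a * x ^ d = 1` in affine 3-space. -/
noncomputable def surfaceX (d r : ℕ) (a : k) : Over (Spec (CommRingCat.of k)) :=
  hypersurface k (MvPolynomial.X 0 ^ r * MvPolynomial.X 2 + MvPolynomial.X 1 ^ d
    + MvPolynomial.C a * MvPolynomial.X 0 ^ d - 1)

/-- The surface `x ^ r * z + y ^ d = 1` in affine 3-space. -/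
noncomputable def surfaceV (d r : ℕ) : Over (Spec (CommRingCat.of k)) :=
  hypersurface k (MvPolynomial.X 0 ^ r * MvPolynomial.X 2 + MvPolynomial.X 1 ^ d - 1)

end Geometry

section Charts

variable {k : Type u} [Field k]

/-- The value in `k` of a `d`-th root of unity. -/
abbrev rootVal {d : ℕ} (w : rootsOfUnity d k) : k := ((w : kˣ) : k)

/-- The polynomials `p_w, q_w`, indexed by the `d`-th roots of unity `w`, that define the charts
`(x, c) ↦ c • (x, p_w x, q_w x)` of the surface `x ^ r * z + y ^ d + a * x ^ d = 1`:
`p_w` has degree at most `r - 1`, `p_w 0 = w`, and `(x, p_w, q_w)` lies on the surface. -/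
structure IsChartFamily (d r : ℕ) (a : k)
    (p q : rootsOfUnity d k → Polynomial k) : Prop where
  natDegree_le : ∀ w, (p w).natDegree ≤ r - 1
  eval_zero : ∀ w, (p w).eval 0 = rootVal w
  equation : ∀ w, Polynomial.X ^ r * q w + p w ^ d + Polynomial.C a * Polynomial.X ^ d = 1

/-- Compatibility of the charts with the action of the group of `d`-th roots of unity:
`p_{l w} (l x) = l * p_w x` and `q_{l w} (l x) = l ^ (-r) * q_w x`. -/
def IsEquivariantFamily (d r : ℕ) (p q : rootsOfUnity d k → Polynomial k) : Prop :=
  ∀ l w : rootsOfUnity d k,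
    (p (l * w)).comp (Polynomial.C (rootVal l) * Polynomial.X)
      = Polynomial.C (rootVal l) * p w ∧
    (q (l * w)).comp (Polynomial.C (rootVal l) * Polynomial.X)
      = Polynomial.C (rootVal l ^ (-(r : ℤ))) * q w

/-- The value `s (x, c)` of `s ∈ k[x, c]`; the inner variable is `x`, the outer one is `c`. -/
noncomputable def evalAt (s : Polynomial (Polynomial k)) (x c : k) : k :=
  (s.eval (Polynomial.C c)).eval x

/-- The descent relation, for all `d`-th roots of unity `l`, all `x ≠ 0` and all `c`:
`l ^ (1 - r') * x ^ r' * s (l⁻¹ x, l ^ (r - 1) * (c + (p_1 x - p_l x) / x ^ r))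
  = x ^ r' * s (x, c) + p'_1 x - p'_l x`. -/
def DescentRelation {d : ℕ} (r r' : ℕ) (p p' : rootsOfUnity d k → Polynomial k)
    (s : Polynomial (Polynomial k)) : Prop :=
  ∀ (l : rootsOfUnity d k) (x c : k), x ≠ 0 →
    rootVal l ^ (1 - (r' : ℤ)) * x ^ r' *
        evalAt s ((rootVal l)⁻¹ * x)
          (rootVal l ^ ((r : ℤ) - 1) * (c + ((p 1).eval x - (p l).eval x) / x ^ r))
      = x ^ r' * evalAt s x c + (p' 1).eval x - (p' l).eval x

/-- The constant polynomials `w`: the family of `p_w` of the surface `x ^ r * z + y ^ d = 1`. -/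
noncomputable def constFamily (k : Type u) [Field k] (d : ℕ) : rootsOfUnity d k → Polynomial k :=
  fun w => Polynomial.C (rootVal w)

/-- `sigma (x, c) = (1 - m)⁻¹ * (p_1 (m x) - p_m (m x)) * c`, for a `d`-th root of unity `m ≠ 1`. -/
noncomputable def sigma {d : ℕ} (p : rootsOfUnity d k → Polynomial k) (m : rootsOfUnity d k) :
    Polynomial (Polynomial k) :=
  Polynomial.C (Polynomial.C (1 - rootVal m)⁻¹ *
    (p 1 - p m).comp (Polynomial.C (rootVal m) * Polynomial.X)) * Polynomial.X

/-- `tau (x, c) = -(a ^ 2 / d ^ 2) * x ^ (2 d - r) + (1 + (a / d) * x ^ d) * c`. -/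
noncomputable def tau (d r : ℕ) (a : k) : Polynomial (Polynomial k) :=
  Polynomial.C (-(Polynomial.C (a ^ 2 / (d : k) ^ 2) * Polynomial.X ^ (2 * d - r))) +
    Polynomial.C (1 + Polynomial.C (a / (d : k)) * Polynomial.X ^ d) * Polynomial.X

end Charts

end PseudoPlane

namespace PseudoPlane

/-! Everything rests on `(1 + u) ^ d ≡ 1 + d u` modulo `u ^ 2`, with `u` a multiple of `x ^ d` and
`r ≤ 2 d`: modulo `x ^ r`, `1 - (a/d) x ^ d` is a `d`-th root of `1 - a x ^ d`. A `d`-th root with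
given nonzero constant term is unique modulo `x ^ r` in characteristic zero, whence `p_l`
(`IsChartFamily.eq_chartPoly`). Then `sigma` is `p_1(x) c`, and both descent relations are direct
computations. The isomorphism is explicit and does not use the descent relations. With `α = (a -
b)/d`, the pair `(y, t)` undergoes the matrix with rows `(1 + α x ^ d, x ^ r)` and `(α ^ 2 x ^
(2d-r), -(1 - α x ^ d))`, of determinant `-1`, whose inverse is the same matrix for `-α`. The new
`y` forces the new `z` (`pow_dvd_shear`); `shearCorrection_swap` shows that `z` returns to itself.
The case `b = 0` is the claim. -/

open Polynomial in
lemma exists_one_add_pow_eq {R : Type*} [CommRing R] (u : R) (n : ℕ) :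
    ∃ e : R, (1 + u) ^ n = 1 + n * u + e * u ^ 2 := by
  obtain ⟨e, he⟩ := powAddExpansion 1 u n
  exact ⟨e, by simpa using he⟩

/-! ### Charts: `d`-th roots modulo `x ^ r` and the descent relations -/

section Charts

open Polynomial

variable {k : Type u} [Field k]

lemma rootVal_pow {d : ℕ} (w : rootsOfUnity d k) : rootVal w ^ d = 1 := by
  have h := (mem_rootsOfUnity d (w : kˣ)).mp w.2
  rw [rootVal, ← Units.val_pow_eq_pow_val, h, Units.val_one]

lemma rootVal_ne_zero {d : ℕ} (w : rootsOfUnity d k) : rootVal w ≠ 0 :=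
  (w : kˣ).ne_zero

lemma rootVal_mul {d : ℕ} (v w : rootsOfUnity d k) :
    rootVal (v * w) = rootVal v * rootVal w := by
  simp [rootVal]

lemma rootVal_ne_one {d : ℕ} {w : rootsOfUnity d k} (hw : w ≠ 1) : rootVal w ≠ 1 := by
  intro h
  apply hw
  ext
  simpa using h

/-- The explicit polynomial `l - (a / d) * l * x ^ d`. -/
noncomputable def chartPoly (d : ℕ) (a l : k) : k[X] :=
  C l - C (a / (d : k) * l) * X ^ d

lemma natDegree_chartPoly_le {d r : ℕ} (hdr : d < r) (a l : k) :
    (chartPoly d a l).natDegree ≤ r - 1 := by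
  refine (natDegree_sub_le _ _).trans (max_le ?_ ?_)
  · simp
  · exact (natDegree_C_mul_X_pow_le _ _).trans (by omega)

lemma eval_zero_chartPoly {d : ℕ} (hd : d ≠ 0) (a l : k) : (chartPoly d a l).eval 0 = l := by
  simp [chartPoly, hd]

lemma X_pow_dvd_chartPoly [CharZero k] {d r : ℕ} (hd : d ≠ 0) (hr : r ≤ 2 * d) (a l : k)
    (hl : l ^ d = 1) :
    X ^ r ∣ 1 - chartPoly d a l ^ d - C a * X ^ d := by
  obtain ⟨e, he⟩ := exists_one_add_pow_eq (-(C (a / (d : k)) * X ^ d) : k[X]) d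
  have hp : chartPoly d a l = C l * (1 + -(C (a / (d : k)) * X ^ d)) := by
    simp only [chartPoly, C_mul]; ring
  have ha : (d : k[X]) * C (a / (d : k)) = C a := by
    rw [← C_eq_natCast, ← C_mul, mul_div_cancel₀ _ (Nat.cast_ne_zero.mpr hd)]
  have hx : (X : k[X]) ^ (2 * d) = X ^ r * X ^ (2 * d - r) := by
    rw [← pow_add, Nat.add_sub_cancel' hr]
  rw [hp, mul_pow, ← C_pow, hl, he]
  refine ⟨-(e * C (a / (d : k)) ^ 2 * X ^ (2 * d - r)), ?_⟩
  rw [C_1]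
  linear_combination X ^ d * ha - e * C (a / (d : k)) ^ 2 * hx

/-- Two `d`-th roots of the same polynomial modulo `x ^ r` agree modulo `x ^ r` as soon as they
agree at `0` and do not vanish there. -/
lemma X_pow_dvd_sub_of_dvd_pow_sub_pow [CharZero k] {d r : ℕ} (hd : d ≠ 0) {p q : k[X]}
    (h0 : p.eval 0 = q.eval 0) (hp : p.eval 0 ≠ 0) (h : X ^ r ∣ p ^ d - q ^ d) :
    X ^ r ∣ p - q := by
  rw [← geom_sum₂_mul] at h
  -- The cofactor of `p - q` takes the value `d * p(0) ^ (d - 1) ≠ 0` at `0`, so the prime `X` does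
  -- not divide it.
  refine prime_X.pow_dvd_of_dvd_mul_left r ?_ h
  rw [X_dvd_iff, coeff_zero_eq_eval_zero, eval_finsetSum]
  simp only [eval_mul, eval_pow, ← h0]
  rw [geom_sum₂_self]
  exact mul_ne_zero (Nat.cast_ne_zero.mpr hd) (pow_ne_zero _ hp)

lemma IsChartFamily.eq_chartPoly [CharZero k] {d r : ℕ} (hdr : d < r) (hr : r < 2 * d) {a : k}
    {p q : rootsOfUnity d k → k[X]} (h : IsChartFamily d r a p q) (l : rootsOfUnity d k) :
    p l = chartPoly d a (rootVal l) := by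
  have hd : d ≠ 0 := by omega
  have hdvd : X ^ r ∣ p l - chartPoly d a (rootVal l) := by
    refine X_pow_dvd_sub_of_dvd_pow_sub_pow hd ?_ ?_ ?_
    · rw [h.eval_zero, eval_zero_chartPoly hd]
    · rw [h.eval_zero]; exact rootVal_ne_zero l
    · have h1 := X_pow_dvd_chartPoly hd hr.le a (rootVal l) (rootVal_pow l)
      have h2 : X ^ r ∣ 1 - p l ^ d - C a * X ^ d :=
        ⟨q l, by linear_combination -h.equation l⟩
      convert dvd_sub h1 h2 using 1
      ring
  rw [← sub_eq_zero]
  refine eq_zero_of_dvd_of_natDegree_lt hdvd ?_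
  rw [natDegree_X_pow]
  have := (natDegree_sub_le (p l) (chartPoly d a (rootVal l))).trans
    (max_le (h.natDegree_le l) (natDegree_chartPoly_le hdr a _))
  omega

lemma existsUnique_isChartFamily [CharZero k] {d r : ℕ} (hdr : d < r) (hr : r < 2 * d) (a : k) :
    ∃! pq : (rootsOfUnity d k → k[X]) × (rootsOfUnity d k → k[X]),
      IsChartFamily d r a pq.1 pq.2 := by
  have hd : d ≠ 0 := by omega
  choose q hq using fun l : rootsOfUnity d k =>
    X_pow_dvd_chartPoly hd hr.le a (rootVal l) (rootVal_pow l)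
  have hpq : IsChartFamily d r a (fun l => chartPoly d a (rootVal l)) q :=
    ⟨fun l => natDegree_chartPoly_le hdr a _, fun l => eval_zero_chartPoly hd a _,
      fun l => by linear_combination -hq l⟩
  refine ⟨(_, q), hpq, ?_⟩
  rintro ⟨p', q'⟩ h
  have hp : p' = fun l => chartPoly d a (rootVal l) := funext fun l => h.eq_chartPoly hdr hr l
  subst hp
  refine Prod.ext rfl (funext fun l => ?_)
  refine mul_left_cancel₀ (pow_ne_zero r (X_ne_zero (R := k))) ?_
  linear_combination h.equation l - hpq.equation l

/-- Only `x ^ d` occurs, and it is invariant under `x ↦ l x`. The scalar `v` is kept apart from `l`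
to cover both `p_1(m x)` and `p_m(m x)`. -/
lemma chartPoly_comp {d : ℕ} (a w : k) {l : k} (hl : l ^ d = 1) (v : k) :
    (chartPoly d a (v * w)).comp (C l * X) = C v * chartPoly d a w := by
  simp only [chartPoly, sub_comp, mul_comp, C_comp, pow_comp, X_comp, mul_pow, ← C_pow, hl]
  simp only [C_mul, C_1]
  ring

lemma IsChartFamily.isEquivariantFamily [CharZero k] {d r : ℕ} (hdr : d < r) (hr : r < 2 * d)
    {a : k} {p q : rootsOfUnity d k → k[X]} (h : IsChartFamily d r a p q) :
    IsEquivariantFamily d r p q := by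
  intro l w
  have hp : (p (l * w)).comp (C (rootVal l) * X) = C (rootVal l) * p w := by
    rw [h.eq_chartPoly hdr hr, h.eq_chartPoly hdr hr, rootVal_mul,
      chartPoly_comp a _ (rootVal_pow l)]
  refine ⟨hp, ?_⟩
  have hl : C (rootVal l) ^ d = (1 : k[X]) := by rw [← C_pow, rootVal_pow, C_1]
  have hE := congrArg (fun s : k[X] => s.comp (C (rootVal l) * X)) (h.equation (l * w))
  simp only [add_comp, mul_comp, pow_comp, X_comp, C_comp, one_comp, hp, mul_pow, hl,
    one_mul] at hE
  have hc : C (rootVal l) ^ r * C (rootVal l ^ (-(r : ℤ))) = (1 : k[X]) := by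
    rw [← C_pow, ← C_mul, zpow_neg, zpow_natCast,
      mul_inv_cancel₀ (pow_ne_zero _ (rootVal_ne_zero l)), C_1]
  have hne : C (rootVal l) ^ r * X ^ r ≠ (0 : k[X]) :=
    mul_ne_zero (pow_ne_zero _ (C_ne_zero.mpr (rootVal_ne_zero l))) (pow_ne_zero _ X_ne_zero)
  -- Substituting `l x` in the equation for `l w` gives the equation for `w`, except that `x ^ r
  -- q_w` is replaced by `l ^ r x ^ r q_{l w}(l x)`.
  refine mul_left_cancel₀ hne ?_
  linear_combination hE - h.equation w - X ^ r * q w * hc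

/-- The difference `p_1(m x) - p_m(m x)` is `(1 - m) p_1(x)`, so `m` cancels. -/
lemma sigma_eq {d : ℕ} {a : k} {p : rootsOfUnity d k → k[X]}
    (hp : ∀ l, p l = chartPoly d a (rootVal l)) {m : rootsOfUnity d k} (hm : m ≠ 1) :
    sigma p m = C (chartPoly d a 1) * X := by
  have hm' : 1 - rootVal m ≠ 0 := sub_ne_zero.mpr (rootVal_ne_one hm).symm
  have h1 : (p 1).comp (C (rootVal m) * X) = chartPoly d a 1 := by
    have := chartPoly_comp a 1 (rootVal_pow m) 1
    rw [hp, rootVal, OneMemClass.coe_one, Units.val_one]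
    simpa using this
  have h2 : (p m).comp (C (rootVal m) * X) = C (rootVal m) * chartPoly d a 1 := by
    rw [hp, ← chartPoly_comp a 1 (rootVal_pow m), mul_one]
  rw [sigma, sub_comp, h1, h2]
  congr 2
  have hc : C (1 - rootVal m)⁻¹ * (1 - C (rootVal m)) = (1 : k[X]) := by
    rw [← C_1, ← C_sub, ← C_mul, inv_mul_cancel₀ hm']
  linear_combination chartPoly d a 1 * hc

lemma zpow_mul_zpow_sub {l : k} (hl : l ≠ 0) (r : ℕ) :
    l ^ (1 - (r : ℤ)) * l ^ ((r : ℤ) - 1) = 1 := by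
  rw [← zpow_add₀ hl]
  simp

lemma descentRelation_sigma {d r : ℕ} {a : k} {p : rootsOfUnity d k → k[X]}
    (hp : ∀ l, p l = chartPoly d a (rootVal l)) {m : rootsOfUnity d k} (hm : m ≠ 1) :
    DescentRelation r r (constFamily k d) p (sigma p m) := by
  intro l x c hx
  have hl := zpow_mul_zpow_sub (rootVal_ne_zero l) r
  have hxr : x ^ r ≠ 0 := pow_ne_zero _ hx
  have hld : ((rootVal l)⁻¹ * x) ^ d = x ^ d := by rw [mul_pow, inv_pow, rootVal_pow]; simp
  have h1 : rootVal (1 : rootsOfUnity d k) = 1 := by simp [rootVal]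
  rw [sigma_eq hp hm, hp, hp, h1]
  simp only [evalAt, chartPoly, constFamily, eval_mul, eval_C, eval_X, eval_sub, eval_pow, hld, h1]
  generalize rootVal l ^ (1 - (r : ℤ)) = u at *
  generalize rootVal l ^ ((r : ℤ) - 1) = v at *
  have hdiv : (1 - rootVal l) / x ^ r * x ^ r = 1 - rootVal l := div_mul_cancel₀ _ hxr
  generalize (1 - rootVal l) / x ^ r = w at *
  generalize a / (d : k) = α at *
  linear_combination (1 - α * x ^ d) * x ^ r * (c + w) * hl + (1 - α * x ^ d) * hdiv

lemma descentRelation_tau {d r : ℕ} (hr : r ≤ 2 * d) {a : k} {p : rootsOfUnity d k → k[X]}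
    (hp : ∀ l, p l = chartPoly d a (rootVal l)) :
    DescentRelation r r p (constFamily k d) (tau d r a) := by
  intro l x c hx
  have hl0 := rootVal_ne_zero l
  have hl := zpow_mul_zpow_sub hl0 r
  have hxr : x ^ r ≠ 0 := pow_ne_zero _ hx
  have hld : ((rootVal l)⁻¹ * x) ^ d = x ^ d := by rw [mul_pow, inv_pow, rootVal_pow]; simp
  have h1 : rootVal (1 : rootsOfUnity d k) = 1 := by simp [rootVal]
  have hx2 : x ^ r * x ^ (2 * d - r) = (x ^ d) ^ 2 := by
    rw [← pow_add, Nat.add_sub_cancel' hr, mul_comm, pow_mul]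
  -- The total exponent of `l` is `1 - r - (2d - r) = 1 - 2d`, and `l ^ (2d) = 1`.
  have hl2 : rootVal l ^ (1 - (r : ℤ)) * ((rootVal l)⁻¹ * x) ^ (2 * d - r)
      = rootVal l * x ^ (2 * d - r) := by
    have : rootVal l ^ (1 - (r : ℤ)) * ((rootVal l)⁻¹) ^ (2 * d - r) = rootVal l := by
      rw [inv_pow, ← zpow_natCast, ← zpow_neg, ← zpow_add₀ hl0, Nat.cast_sub hr]
      have : (1 - (r : ℤ) + -(((2 * d : ℕ) : ℤ) - r)) = 1 - ((d * 2 : ℕ) : ℤ) := by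
        push_cast; ring
      rw [this, zpow_sub₀ hl0, zpow_natCast, pow_mul, rootVal_pow]
      simp
    rw [mul_pow, ← mul_assoc, this]
  rw [hp, hp, h1]
  simp only [evalAt, tau, chartPoly, constFamily, eval_mul, eval_C, eval_X, eval_sub, eval_pow,
    eval_add, eval_neg, eval_one, hld, h1]
  generalize rootVal l ^ (1 - (r : ℤ)) = u at *
  generalize rootVal l ^ ((r : ℤ) - 1) = v at *
  generalize ((rootVal l)⁻¹ * x) ^ (2 * d - r) = y at *
  generalize x ^ (2 * d - r) = s at *
  have hdiv : (1 * 1 - a / d * 1 * x ^ d - (rootVal l - a / d * rootVal l * x ^ d)) / x ^ r * x ^ r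
      = (1 - rootVal l) * (1 - a / d * x ^ d) := by
    rw [div_mul_cancel₀ _ hxr]; ring
  rw [← div_pow]
  simp only [one_mul] at hdiv
  generalize (1 - a / d * 1 * x ^ d - (rootVal l - a / d * rootVal l * x ^ d)) / x ^ r = w at *
  generalize a / (d : k) = α at *
  -- The product `(1 + α x ^ d)(1 - α x ^ d)(1 - l)` misses `1 - l` by `(1 - l) α ^ 2 x ^ (2d)`; the
  -- monomial term of `tau`, multiplied by `l`, makes up for it.
  linear_combination (-α ^ 2 * x ^ r) * hl2 + (1 + α * x ^ d) * x ^ r * (c + w) * hl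
    + (1 + α * x ^ d) * hdiv + α ^ 2 * (1 - rootVal l) * hx2

end Charts

/-! ### Cylinders: an explicit isomorphism of coordinate rings -/

section Cylinder

open MvPolynomial
open scoped TensorProduct

/-- Modulo `x ^ r` the `d`-th power is `(1 + (a - b) x ^ d) y ^ d`, and `1 - b x ^ d` is `(1 + (a -
b) x ^ d)(1 - a x ^ d)`. -/
lemma pow_dvd_shear {R : Type*} [CommRing R] {d r : ℕ} (hr : r ≤ 2 * d) (x y t α a b : R)
    (h : a - b = d * α) :
    x ^ r ∣ (1 - b * x ^ d - ((1 + α * x ^ d) * y + x ^ r * t) ^ d)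
      - (1 + (a - b) * x ^ d) * (1 - a * x ^ d - y ^ d) := by
  obtain ⟨e, he⟩ := exists_one_add_pow_eq (α * x ^ d) d
  obtain ⟨g, hg⟩ := sub_dvd_pow_sub_pow ((1 + α * x ^ d) * y + x ^ r * t) ((1 + α * x ^ d) * y) d
  rw [mul_pow, he] at hg
  have hx : x ^ (2 * d) = x ^ r * x ^ (2 * d - r) := by rw [← pow_add, Nat.add_sub_cancel' hr]
  refine ⟨-(t * g) + (a * (a - b) - e * α ^ 2 * y ^ d) * x ^ (2 * d - r), ?_⟩
  linear_combination -hg + (a * (a - b) - e * α ^ 2 * y ^ d) * hx + x ^ d * y ^ d * h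

variable {k : Type u} [Field k]

/-- The equation of the surface `x ^ r * z + y ^ d + a * x ^ d = 1`. -/
noncomputable def surfacePoly (d r : ℕ) (a : k) : MvPolynomial (Fin 3) k :=
  X 0 ^ r * X 2 + X 1 ^ d + C a * X 0 ^ d - 1

/-- Here `X 2` plays the line coordinate `t`, not `z`. A universal polynomial quotient can be
evaluated in any `k`-algebra. -/
lemma exists_shear_correction [CharZero k] {d r : ℕ} (hd : d ≠ 0) (hr : r ≤ 2 * d) (a b : k) :
    ∃ e : MvPolynomial (Fin 3) k,
      1 - C b * X 0 ^ d - ((1 + C ((a - b) / d) * X 0 ^ d) * X 1 + X 0 ^ r * X 2) ^ d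
        = (1 + C (a - b) * X 0 ^ d) * (1 - C a * X 0 ^ d - X 1 ^ d) + X 0 ^ r * e := by
  have h : (C a - C b : MvPolynomial (Fin 3) k) = (d : MvPolynomial (Fin 3) k) * C ((a - b) / d) := by
    rw [← map_natCast (C : k →+* MvPolynomial (Fin 3) k), ← C_mul, ← C_sub,
      mul_div_cancel₀ _ (Nat.cast_ne_zero.mpr hd)]
  obtain ⟨e, he⟩ := pow_dvd_shear hr (X 0 : MvPolynomial (Fin 3) k) (X 1) (X 2) _ _ _ h
  exact ⟨e, by rw [C_sub]; linear_combination he⟩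

/-- The coordinate ring of the cylinder over the surface `x ^ r * z + y ^ d + a * x ^ d = 1`. -/
def CylinderRing (d r : ℕ) (a : k) : Type u :=
  CoordRing k (surfacePoly d r a) ⊗[k] Polynomial k

noncomputable instance (d r : ℕ) (a : k) : CommRing (CylinderRing d r a) :=
  inferInstanceAs (CommRing (CoordRing k (surfacePoly d r a) ⊗[k] Polynomial k))

noncomputable instance (d r : ℕ) (a : k) : Algebra k (CylinderRing d r a) :=
  inferInstanceAs (Algebra k (CoordRing k (surfacePoly d r a) ⊗[k] Polynomial k))

/-- The morphism from the coordinate ring of a cylinder given by a point of the surface and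
a point of the affine line. -/
noncomputable def cylinderLift {B : Type*} [CommRing B] [Algebra k B] {d r : ℕ} {a : k}
    (x y z t : B) (h : x ^ r * z + y ^ d + algebraMap k B a * x ^ d = 1) :
    CylinderRing d r a →ₐ[k] B :=
  Algebra.TensorProduct.lift
    (Ideal.Quotient.liftₐ _ (aeval ![x, y, z]) (fun f hf => by
      refine (RingHom.mem_ker (f := aeval ![x, y, z])).mp
        ((Ideal.span_singleton_le_iff_mem _).mpr ?_ hf)
      rw [RingHom.mem_ker]
      simp [surfacePoly, h]))
    (Polynomial.aeval t) (fun _ _ => Commute.all _ _)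

/-- The coordinate functions `x, y, z` on the cylinder. -/
noncomputable def cylinderCoord (d r : ℕ) (a : k) (i : Fin 3) : CylinderRing d r a :=
  Ideal.Quotient.mk _ (X i) ⊗ₜ 1

/-- The coordinate on the line factor of the cylinder. -/
noncomputable def cylinderParam (d r : ℕ) (a : k) : CylinderRing d r a :=
  1 ⊗ₜ Polynomial.X

section

variable {B : Type*} [CommRing B] [Algebra k B] {d r : ℕ} {a : k}

lemma cylinderLift_coord (x y z t : B)
    (h : x ^ r * z + y ^ d + algebraMap k B a * x ^ d = 1) (i : Fin 3) :
    cylinderLift x y z t h (cylinderCoord d r a i) = ![x, y, z] i := by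
  refine (Algebra.TensorProduct.lift_tmul _ _ _ _ _).trans ?_
  rw [map_one, mul_one]
  exact aeval_X _ _

lemma cylinderLift_param (x y z t : B)
    (h : x ^ r * z + y ^ d + algebraMap k B a * x ^ d = 1) :
    cylinderLift x y z t h (cylinderParam d r a) = t := by
  refine (Algebra.TensorProduct.lift_tmul _ _ _ _ _).trans ?_
  rw [map_one, one_mul, Polynomial.aeval_X]

lemma cylinder_hom_ext {f g : CylinderRing d r a →ₐ[k] B}
    (hc : ∀ i, f (cylinderCoord d r a i) = g (cylinderCoord d r a i))
    (ht : f (cylinderParam d r a) = g (cylinderParam d r a)) : f = g := by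
  refine Algebra.TensorProduct.ext ?_ ?_
  · refine Ideal.Quotient.algHom_ext _ (MvPolynomial.algHom_ext fun i => ?_)
    exact hc i
  · exact Polynomial.algHom_ext ht

lemma cylinderCoord_equation (d r : ℕ) (a : k) :
    cylinderCoord d r a 0 ^ r * cylinderCoord d r a 2 + cylinderCoord d r a 1 ^ d
      + algebraMap k (CylinderRing d r a) a * cylinderCoord d r a 0 ^ d = 1 := by
  let φ : MvPolynomial (Fin 3) k →ₐ[k] CylinderRing d r a :=
    (Algebra.TensorProduct.includeLeft (R := k) (S := k) (A := CoordRing k (surfacePoly d r a))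
      (B := Polynomial k)).comp (Ideal.Quotient.mkₐ k (Ideal.span {surfacePoly d r a}))
  have hX : ∀ i, φ (X i) = cylinderCoord d r a i := fun i => rfl
  have h : φ (surfacePoly d r a) = 0 := by
    have : Ideal.Quotient.mkₐ k (Ideal.span {surfacePoly d r a}) (surfacePoly d r a) = 0 :=
      Ideal.Quotient.eq_zero_iff_mem.mpr (Ideal.mem_span_singleton_self _)
    exact (congrArg (Algebra.TensorProduct.includeLeft (R := k) (S := k)
      (A := CoordRing k (surfacePoly d r a)) (B := Polynomial k)) this).trans (map_zero _)
  simp only [surfacePoly, map_sub, map_add, map_mul, map_pow, map_one, hX,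
    algHom_C] at h
  exact sub_eq_zero.mp h

end

/-! ### The shear between two cylinders and its inverse -/

section Shear

variable [CharZero k] {d r : ℕ} (hd : d ≠ 0) (hr : r ≤ 2 * d)

/-- The correction polynomial in `exists_shear_correction`. -/
noncomputable def shearCorrection (a b : k) : MvPolynomial (Fin 3) k :=
  (exists_shear_correction hd hr a b).choose

lemma shearCorrection_spec {B : Type*} [CommRing B] [Algebra k B] (a b : k) (x y t : B) :
    1 - algebraMap k B b * x ^ d
        - ((1 + algebraMap k B ((a - b) / d) * x ^ d) * y + x ^ r * t) ^ d
      = (1 + algebraMap k B (a - b) * x ^ d) * (1 - algebraMap k B a * x ^ d - y ^ d)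
        + x ^ r * aeval ![x, y, t] (shearCorrection hd hr a b) := by
  have h : _ = _ + _ * shearCorrection hd hr a b :=
    (exists_shear_correction hd hr a b).choose_spec
  generalize shearCorrection hd hr a b = e at *
  have h' := congrArg (aeval ![x, y, t]) h
  simpa only [map_add, map_mul, map_pow, map_sub, map_one, aeval_X, algHom_C,
    Matrix.cons_val] using h'

/-- Composing the defining relations of the two corrections, the shears of `y` cancel and `x ^ r`
factors out. It is cancelled here, in a domain, before specializing to the cylinder. -/
lemma shearCorrection_swap_X (a b : k) :
    (1 + C (b - a) * X 0 ^ d) * shearCorrection hd hr a b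
      + aeval ![X 0, (1 + C ((a - b) / d) * X 0 ^ d) * X 1 + X 0 ^ r * X 2,
          C ((a - b) / d) ^ 2 * X 0 ^ (2 * d - r) * X 1
            - (1 + C ((b - a) / d) * X 0 ^ d) * X 2] (shearCorrection hd hr b a)
      = C (a - b) ^ 2 * X 0 ^ (2 * d - r)
        * (1 - C a * X 0 ^ d - X 1 ^ d : MvPolynomial (Fin 3) k) := by
  have hx : (X 0 : MvPolynomial (Fin 3) k) ^ r * X 0 ^ (2 * d - r) = X 0 ^ d * X 0 ^ d := by
    rw [← pow_add, ← pow_add, Nat.add_sub_cancel' hr, two_mul]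
  have h1 : _ = _ + _ * shearCorrection hd hr a b :=
    (exists_shear_correction hd hr a b).choose_spec
  have h2 := shearCorrection_spec hd hr b a (X 0 : MvPolynomial (Fin 3) k)
    ((1 + C ((a - b) / d) * X 0 ^ d) * X 1 + X 0 ^ r * X 2)
    (C ((a - b) / d) ^ 2 * X 0 ^ (2 * d - r) * X 1 - (1 + C ((b - a) / d) * X 0 ^ d) * X 2)
  have hn : b - a = -(a - b) := by ring
  simp only [algebraMap_eq, hn, neg_div, C_neg] at h2 ⊢
  generalize shearCorrection hd hr a b = e at *
  generalize C ((a - b) / (d : k)) = α at *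
  have hy : (1 + -α * X 0 ^ d) * ((1 + α * X 0 ^ d) * X 1 + X 0 ^ r * X 2)
      + X 0 ^ r * (α ^ 2 * X 0 ^ (2 * d - r) * X 1 - (1 + -α * X 0 ^ d) * X 2)
      = (X 1 : MvPolynomial (Fin 3) k) := by
    linear_combination α ^ 2 * X 1 * hx
  rw [hy] at h2
  generalize aeval (R := k) (S₁ := MvPolynomial (Fin 3) k) _ (shearCorrection hd hr b a) = e' at *
  refine mul_left_cancel₀ (pow_ne_zero r (X_ne_zero (R := k) (0 : Fin 3))) ?_
  linear_combination -h2 - (1 - C (a - b) * X 0 ^ d) * h1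
    - C (a - b) ^ 2 * (1 - C a * X 0 ^ d - X 1 ^ d) * hx

lemma shearCorrection_swap {B : Type*} [CommRing B] [Algebra k B] (a b : k) (x y t : B) :
    (1 + algebraMap k B (b - a) * x ^ d) * aeval ![x, y, t] (shearCorrection hd hr a b)
      + aeval ![x, (1 + algebraMap k B ((a - b) / d) * x ^ d) * y + x ^ r * t,
          algebraMap k B ((a - b) / d) ^ 2 * x ^ (2 * d - r) * y
            - (1 + algebraMap k B ((b - a) / d) * x ^ d) * t] (shearCorrection hd hr b a)
      = algebraMap k B (a - b) ^ 2 * x ^ (2 * d - r) * (1 - algebraMap k B a * x ^ d - y ^ d) := by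
  have h := congrArg (aeval ![x, y, t]) (shearCorrection_swap_X hd hr a b)
  simp only [map_add, map_mul, map_pow, map_sub, map_one, aeval_X, algHom_C,
    Matrix.cons_val] at h ⊢
  rw [← h]
  congr 1
  rw [← AlgHom.comp_apply]
  refine DFunLike.congr_fun (MvPolynomial.algHom_ext fun i => ?_) _
  fin_cases i <;> simp

/-- The comparison morphism between the coordinate rings of two cylinders. -/
noncomputable def cylinderShear (a b : k) : CylinderRing d r b →ₐ[k] CylinderRing d r a :=
  cylinderLift (cylinderCoord d r a 0)
    ((1 + algebraMap k _ ((a - b) / d) * cylinderCoord d r a 0 ^ d) * cylinderCoord d r a 1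
      + cylinderCoord d r a 0 ^ r * cylinderParam d r a)
    -- On the source surface `1 - a x ^ d - y ^ d = x ^ r z`; this is the shear relation divided by
    -- `x ^ r`.
    ((1 + algebraMap k _ (a - b) * cylinderCoord d r a 0 ^ d) * cylinderCoord d r a 2
      + aeval ![cylinderCoord d r a 0, cylinderCoord d r a 1, cylinderParam d r a]
          (shearCorrection hd hr a b))
    (algebraMap k _ ((a - b) / d) ^ 2 * cylinderCoord d r a 0 ^ (2 * d - r)
        * cylinderCoord d r a 1
      - (1 + algebraMap k _ ((b - a) / d) * cylinderCoord d r a 0 ^ d) * cylinderParam d r a)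
    (by
      have h := shearCorrection_spec hd hr a b (cylinderCoord d r a 0) (cylinderCoord d r a 1)
        (cylinderParam d r a)
      have he := cylinderCoord_equation d r a
      linear_combination -h
        + (1 + algebraMap k _ (a - b) * cylinderCoord d r a 0 ^ d) * he)

lemma cylinderShear_comp (a b : k) :
    (cylinderShear hd hr a b).comp (cylinderShear hd hr b a) = AlgHom.id k _ := by
  have hs := shearCorrection_swap hd hr a b (cylinderCoord d r a 0) (cylinderCoord d r a 1)
    (cylinderParam d r a)
  have he := cylinderCoord_equation d r a
  have hx : cylinderCoord d r a 0 ^ r * cylinderCoord d r a 0 ^ (2 * d - r)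
      = cylinderCoord d r a 0 ^ d * cylinderCoord d r a 0 ^ d := by
    rw [← pow_add, ← pow_add, Nat.add_sub_cancel' hr, two_mul]
  have h0 : cylinderShear hd hr a b (cylinderCoord d r b 0) = _ := cylinderLift_coord _ _ _ _ _ 0
  have h1 : cylinderShear hd hr a b (cylinderCoord d r b 1) = _ := cylinderLift_coord _ _ _ _ _ 1
  have h2 : cylinderShear hd hr a b (cylinderCoord d r b 2) = _ := cylinderLift_coord _ _ _ _ _ 2
  have ht : cylinderShear hd hr a b (cylinderParam d r b) = _ := cylinderLift_param _ _ _ _ _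
  have hcorr : cylinderShear hd hr a b (aeval ![cylinderCoord d r b 0, cylinderCoord d r b 1,
      cylinderParam d r b] (shearCorrection hd hr b a))
      = aeval ![cylinderShear hd hr a b (cylinderCoord d r b 0),
          cylinderShear hd hr a b (cylinderCoord d r b 1),
          cylinderShear hd hr a b (cylinderParam d r b)] (shearCorrection hd hr b a) := by
    rw [← AlgHom.comp_apply]
    refine DFunLike.congr_fun (MvPolynomial.algHom_ext fun i => ?_) _
    fin_cases i <;> simp
  have hn : (b - a) / (d : k) = -((a - b) / d) := by ring
  have hn' : b - a = -(a - b) := by ring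
  simp only [Matrix.cons_val] at h0 h1 h2
  rw [h0, h1, ht] at hcorr
  rw [← hcorr] at hs
  refine cylinder_hom_ext (fun i => ?_) ?_
  · have hi : cylinderShear hd hr b a (cylinderCoord d r a i) = _ :=
      cylinderLift_coord _ _ _ _ _ i
    rw [AlgHom.comp_apply, hi, AlgHom.id_apply]
    fin_cases i
    · exact h0
    · simp only [Fin.mk_one, Matrix.cons_val, map_add, map_mul, map_pow, map_one, h0, h1, ht,
        AlgHom.commutes, hn, map_neg]
      linear_combination algebraMap k (CylinderRing d r a) ((a - b) / d) ^ 2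
        * cylinderCoord d r a 1 * hx
    · simp only [Fin.reduceFinMk, Matrix.cons_val, map_add, map_mul, map_pow, map_one, h0, h2,
        AlgHom.commutes]
      simp only [hn', map_neg] at hs ⊢
      -- The round trip multiplies `z` by `1 - (a - b) ^ 2 x ^ (2d)`; the corrections add `(a - b) ^
      -- 2 x ^ (2d-r) (1 - a x ^ d - y ^ d)`, which the surface equation turns into the missing
      -- term.
      linear_combination hs
        - algebraMap k (CylinderRing d r a) (a - b) ^ 2
          * cylinderCoord d r a 0 ^ (2 * d - r) * he
        + algebraMap k (CylinderRing d r a) (a - b) ^ 2 * cylinderCoord d r a 2 * hx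
  · have hp : cylinderShear hd hr b a (cylinderParam d r a) = _ :=
      cylinderLift_param _ _ _ _ _
    rw [AlgHom.comp_apply, hp, AlgHom.id_apply]
    simp only [map_add, map_sub, map_mul, map_pow, map_one, h0, h1, ht, AlgHom.commutes, hn,
      map_neg]
    linear_combination algebraMap k (CylinderRing d r a) ((a - b) / d) ^ 2
      * cylinderParam d r a * hx

/-- The coordinate rings of the cylinders over the surfaces `x ^ r * z + y ^ d + a * x ^ d = 1`,
for varying `a`, are isomorphic. -/
noncomputable def cylinderEquiv (a b : k) : CylinderRing d r b ≃ₐ[k] CylinderRing d r a :=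
  AlgEquiv.ofAlgHom (cylinderShear hd hr a b) (cylinderShear hd hr b a)
    (cylinderShear_comp hd hr a b) (cylinderShear_comp hd hr b a)

end Shear

/-- The product of affine `k`-schemes is the spectrum of the tensor product. -/
noncomputable def tensorObjSpecIso (k S T : Type u) [CommRing k] [CommRing S] [CommRing T]
    [Algebra k S] [Algebra k T] :
    MonoidalCategoryStruct.tensorObj
        (Over.mk (Spec.map (CommRingCat.ofHom (algebraMap k S))))
        (Over.mk (Spec.map (CommRingCat.ofHom (algebraMap k T)))) ≅
      Over.mk (Spec.map (CommRingCat.ofHom (algebraMap k (S ⊗[k] T)))) :=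
  Over.isoMk (pullbackSpecIso k S T) (pullbackSpecIso_hom_base k S T)

/-- An isomorphism of `k`-algebras induces an isomorphism of affine `k`-schemes. -/
noncomputable def specIsoOfAlgEquiv {k S T : Type u} [CommRing k] [CommRing S] [CommRing T]
    [Algebra k S] [Algebra k T] (e : T ≃ₐ[k] S) :
    Over.mk (Spec.map (CommRingCat.ofHom (algebraMap k S))) ≅
      Over.mk (Spec.map (CommRingCat.ofHom (algebraMap k T))) :=
  Over.isoMk (Scheme.Spec.mapIso e.toRingEquiv.toCommRingCatIso.op) (by
    change Spec.map (CommRingCat.ofHom (e.toRingEquiv : T →+* S)) ≫ Spec.map _ = Spec.map _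
    rw [← Spec.map_comp, ← CommRingCat.ofHom_comp]
    congr 2
    exact e.toAlgHom.comp_algebraMap)

lemma surfaceV_eq (d r : ℕ) : surfaceV k d r = surfaceX k d r 0 := by
  simp [surfaceV, surfaceX]

end Cylinder

end PseudoPlane

theorem proposition1p4p27 {k : Type u} [Field k] [IsAlgClosed k] [CharZero k]
    (d r : ℕ) (hdr : d < r) (hr : r < 2 * d) (a : k) :
    -- the polynomials `p_w`, `q_w` exist and are uniquely determined
    (∃! pq : (rootsOfUnity d k → Polynomial k) × (rootsOfUnity d k → Polynomial k),
      PseudoPlane.IsChartFamily d r a pq.1 pq.2) ∧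
    (∀ p q : rootsOfUnity d k → Polynomial k, PseudoPlane.IsChartFamily d r a p q →
      PseudoPlane.IsEquivariantFamily d r p q ∧
      -- the formula for `p_l`
      (∀ l : rootsOfUnity d k,
        p l = Polynomial.C (PseudoPlane.rootVal l) -
          Polynomial.C (a / (d : k) * PseudoPlane.rootVal l) * Polynomial.X ^ d) ∧
      -- `sigma` does not depend on the root of unity `m ≠ 1` used to write it
      (∀ m n : rootsOfUnity d k, m ≠ 1 → n ≠ 1 →
        PseudoPlane.sigma p m = PseudoPlane.sigma p n) ∧
      -- the descent relations of `sigma` and `tau`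
      (∀ m : rootsOfUnity d k, m ≠ 1 →
        PseudoPlane.DescentRelation r r (PseudoPlane.constFamily k d) p
          (PseudoPlane.sigma p m)) ∧
      PseudoPlane.DescentRelation r r p (PseudoPlane.constFamily k d)
        (PseudoPlane.tau d r a)) ∧
    -- the two cylinders are isomorphic over `k`
    Nonempty (MonoidalCategoryStruct.tensorObj
        (PseudoPlane.surfaceX k d r a) (PseudoPlane.affineLine k) ≅
      MonoidalCategoryStruct.tensorObj
        (PseudoPlane.surfaceV k d r) (PseudoPlane.affineLine k)) := by
  have hd : d ≠ 0 := by omega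
  refine ⟨PseudoPlane.existsUnique_isChartFamily hdr hr a, fun p q h => ?_, ?_⟩
  · have hp := fun l => h.eq_chartPoly hdr hr l
    refine ⟨h.isEquivariantFamily hdr hr, hp, fun m n hm hn => ?_, fun m hm => ?_, ?_⟩
    · rw [PseudoPlane.sigma_eq hp hm, PseudoPlane.sigma_eq hp hn]
    · exact PseudoPlane.descentRelation_sigma hp hm
    · exact PseudoPlane.descentRelation_tau hr.le hp
  · rw [PseudoPlane.surfaceV_eq]
    exact ⟨PseudoPlane.tensorObjSpecIso k _ _ ≪≫
      PseudoPlane.specIsoOfAlgEquiv (PseudoPlane.cylinderEquiv hd hr.le a 0) ≪≫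
      (PseudoPlane.tensorObjSpecIso k _ _).symm⟩
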